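/- Let $\mathcal M$ be a diffuse finite von Neumann algebra (diffuse: it has no minimal nonzero projections), acting on a complex Hilbert space $\mathcal H$, with a normal faithful tracial state $\tau$. For projections $p,q\in\mathcal M$ let $p\wedge q$ be the projection onto $p\mathcal H\cap q\mathcal H$ and $p\vee q$ the projection onto the closure of $p\mathcal H+q\mathcal H$. Say that projections $e_1,e_2,e_3,f_1,f_2,f_3\in\mathcal M$ are in general position if, whenever $\{i,j,k\}=\{1,2,3\}$, $$e_i\wedge f_j=0\qquad\text{and}\qquad e_k\wedge(e_i\vee e_j)=0 .$$ (a) Let $e_1,e_2,e_3,f_1,f_2,f_3\in\mathcal M$ be projections in general position with $e_i\le f_i$, $\tau(e_i)=\frac13$ and $\tau(f_i)=\frac23$ for $i=1,2,3$. Then for every $\varepsilon>0$ there is a projection $p\in\mathcal M$ such that $$\tau(p)\le\tfrac12+\varepsilon,\qquad \tau(p\wedge e_i)\ge\tfrac16,\qquad \tau(p\wedge f_i)\ge\tfrac13\qquad(1\le i\le 3).$$ (b) Consequently the requirement of property AP$_6$ of the triple $(\{2,4,6\},\{2,4,6\},\{2,4,6\})$ is met by flags in general position. Here a flag is a linearly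 ordered family $(F_t)_{0\le t\le 1}$ of projections in $\mathcal M$ with $\tau(F_t)=t$ for all $t$. If $F^{(1)},F^{(2)},F^{(3)}$ are flags in $\mathcal M$ such that the projections $e_m=F^{(m)}_{2/6}$, $f_m=F^{(m)}_{4/6}$ are in general position, then for every $\varepsilon>0$ there is a projection $p\in\mathcal M$ with $\tau(p)\le\frac36+\varepsilon$ and $$\tau\big(F^{(m)}_{2\ell/6}\wedge p\big)\ge\tfrac{\ell}{6}\qquad(m,\ell\in\{1,2,3\}).$$ -/

import Mathlib

open scoped ComplexOrder

noncomputable section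

namespace HornVN

universe u

variable {H : Type u} [NormedAddCommGroup H] [InnerProductSpace ℂ H] [CompleteSpace H]

/-- The underlying `*`-algebra of a von Neumann algebra, as a type. Its elements are the bounded
operators belonging to `M`; they are ordered by the Loewner order of `H →L[ℂ] H`. -/
abbrev Elt (M : VonNeumannAlgebra H) : Type u := M.toStarSubalgebra

/-- `Proj M` is the set of projections (self-adjoint idempotents) of the von Neumann algebra `M`. -/
def Proj (M : VonNeumannAlgebra H) : Type u :=
  {p : H →L[ℂ] H // p ∈ M ∧ IsStarProjection p}

namespace Proj

variable {M : VonNeumannAlgebra H}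

/-- The range `pH` of a projection. -/
def range (p : Proj M) : Submodule ℂ H := p.1.range

/-- A projection as an element of the algebra `M`. -/
def toElt (p : Proj M) : Elt M := ⟨p.1, p.2.1⟩

/-- The usual order of projections, as self-adjoint operators. -/
instance : PartialOrder (Proj M) := PartialOrder.lift (fun p => p.1) Subtype.val_injective

instance : Zero (Proj M) := ⟨⟨0, zero_mem M, IsStarProjection.zero _⟩⟩

theorem isClosed_range (p : Proj M) : IsClosed (p.range : Set H) :=
  ContinuousLinearMap.IsIdempotentElem.isClosed_range p.2.2.isIdempotentElem

theorem range_invariant (p : Proj M) {y : H →L[ℂ] H} (hy : y ∈ M.commutant) :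
    p.range ∈ Module.End.invtSubmodule (y : H →ₗ[ℂ] H) :=
  (VonNeumannAlgebra.IsStarProjection.mem_iff p.2.2 M).1 p.2.1 y hy

/-- The orthogonal projection onto a closed subspace that is invariant under the commutant
of `M`; it belongs to `M`. -/
def ofSubspace (K : Submodule ℂ H) (hK : IsClosed (K : Set H))
    (hinv : ∀ y ∈ M.commutant, K ∈ Module.End.invtSubmodule (y : H →ₗ[ℂ] H)) : Proj M :=
  haveI : CompleteSpace K := hK.completeSpace_coe
  ⟨K.starProjection,
    (VonNeumannAlgebra.IsStarProjection.mem_iff isStarProjection_starProjection M).2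
      (fun y hy => by rw [Submodule.range_starProjection]; exact hinv y hy),
    isStarProjection_starProjection⟩

theorem range_ofSubspace (K : Submodule ℂ H) (hK : IsClosed (K : Set H))
    (hinv : ∀ y ∈ M.commutant, K ∈ Module.End.invtSubmodule (y : H →ₗ[ℂ] H)) :
    (ofSubspace (M := M) K hK hinv).range = K := by
  have : CompleteSpace K := hK.completeSpace_coe
  exact Submodule.range_starProjection K

theorem le_iff_range_le {p q : Proj M} : p ≤ q ↔ p.range ≤ q.range := by
  obtain ⟨_, hp⟩ := isStarProjection_iff_eq_starProjection_range.1 p.2.2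
  obtain ⟨_, hq⟩ := isStarProjection_iff_eq_starProjection_range.1 q.2.2
  change p.1 ≤ q.1 ↔ p.1.range ≤ q.1.range
  conv_lhs => rw [hp, hq]
  exact Submodule.starProjection_le_starProjection_iff

/-- The lattice of projections: `p ⊓ q` is the projection onto `pH ∩ qH`, and `p ⊔ q` is the
projection onto the closure of `pH + qH`. -/
instance : Lattice (Proj M) where
  inf p q := ofSubspace (p.range ⊓ q.range) (p.isClosed_range.inter q.isClosed_range)
    (fun _ hy => (Module.End.invtSubmodule _).inf_mem
      (p.range_invariant hy) (q.range_invariant hy))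
  sup p q := ofSubspace (p.range ⊔ q.range).topologicalClosure
    (Submodule.isClosed_topologicalClosure _)
    (fun y hy => Submodule.topologicalClosure_mem_invtSubmodule
      ((Module.End.invtSubmodule _).sup_mem (p.range_invariant hy) (q.range_invariant hy)))
  inf_le_left p q := by
    rw [le_iff_range_le, range_ofSubspace]; exact inf_le_left
  inf_le_right p q := by
    rw [le_iff_range_le, range_ofSubspace]; exact inf_le_right
  le_inf p q r h h' := by
    rw [le_iff_range_le] at h h' ⊢
    rw [range_ofSubspace]; exact le_inf h h'
  le_sup_left p q := by
    rw [le_iff_range_le, range_ofSubspace]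
    exact le_sup_left.trans (Submodule.le_topologicalClosure _)
  le_sup_right p q := by
    rw [le_iff_range_le, range_ofSubspace]
    exact le_sup_right.trans (Submodule.le_topologicalClosure _)
  sup_le p q r h h' := by
    rw [le_iff_range_le] at h h' ⊢
    rw [range_ofSubspace]
    exact Submodule.topologicalClosure_minimal _ (sup_le h h') r.isClosed_range

end Proj

/-- `τ` is a normal faithful tracial state on `M`. (A von Neumann algebra that carries one is
automatically finite.) -/
structure IsNormalFaithfulTracialState {M : VonNeumannAlgebra H} (τ : Elt M →ₗ[ℂ] ℂ) : Prop where
  map_one : τ 1 = 1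
  nonneg : ∀ x : Elt M, 0 ≤ τ (star x * x)
  faithful : ∀ x : Elt M, τ (star x * x) = 0 → x = 0
  tracial : ∀ x y : Elt M, τ (x * y) = τ (y * x)
  /-- `τ` preserves suprema of bounded increasing nets of positive elements. -/
  normal : ∀ (D : Set (Elt M)) (x : Elt M), D.Nonempty → DirectedOn (· ≤ ·) D →
    (∀ d ∈ D, 0 ≤ d) → IsLUB D x → IsLUB ((fun d => (τ d).re) '' D) (τ x).re

/-- `M` is diffuse: it has no minimal nonzero projections. -/
def IsDiffuse (M : VonNeumannAlgebra H) : Prop :=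
  ∀ p : Proj M, p ≠ 0 → ∃ q : Proj M, q ≤ p ∧ q ≠ 0 ∧ q ≠ p

/-- The trace `τ(p)` of a projection, as a real number. -/
def tr {M : VonNeumannAlgebra H} (τ : Elt M →ₗ[ℂ] ℂ) (p : Proj M) : ℝ := (τ p.toElt).re

/-- The general position conditions on three pairs of projections:
`eᵢ ∧ fⱼ = 0` and `eₖ ∧ (eᵢ ∨ eⱼ) = 0` whenever `{i, j, k} = {1, 2, 3}`. -/
def GeneralPosition {M : VonNeumannAlgebra H} (e f : Fin 3 → Proj M) : Prop :=
  (∀ i j, i ≠ j → e i ⊓ f j = 0) ∧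
  (∀ i j k, i ≠ j → j ≠ k → i ≠ k → e k ⊓ (e i ⊔ e j) = 0)

/-- A flag: a linearly ordered family `(F t)`, `0 ≤ t ≤ 1`, of projections with `τ(F t) = t`.
The values of `F` outside `[0, 1]` are irrelevant. -/
def IsFlag {M : VonNeumannAlgebra H} (τ : Elt M →ₗ[ℂ] ℂ) (F : ℝ → Proj M) : Prop :=
  (∀ t ∈ Set.Icc (0 : ℝ) 1, tr τ (F t) = t) ∧
  (∀ s ∈ Set.Icc (0 : ℝ) 1, ∀ t ∈ Set.Icc (0 : ℝ) 1, F s ≤ F t ∨ F t ≤ F s)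

/-- The requirement of property `AP_n` of the triple `(I 0, I 1, I 2)` of `r`-element subsets of
`{1, …, n}`, for the given three flags `F 0, F 1, F 2`: for every `ε > 0` there is a projection `p`
with `τ(p) ≤ r/n + ε` such that, for each `m` and each `i ∈ I m`, if `i` is the `ℓ`-th smallest
element of `I m`, then `τ(F m (i/n) ∧ p) ≥ ℓ/n`. -/
def APForFlags {M : VonNeumannAlgebra H} (τ : Elt M →ₗ[ℂ] ℂ) (n r : ℕ) (I : Fin 3 → Finset ℕ)
    (F : Fin 3 → ℝ → Proj M) : Prop :=
  ∀ ε : ℝ, 0 < ε → ∃ p : Proj M, tr τ p ≤ (r : ℝ) / n + ε ∧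
    ∀ m, ∀ i ∈ I m,
      (((I m).filter (fun i' => i' ≤ i)).card : ℝ) / n ≤ tr τ (F m ((i : ℝ) / n) ⊓ p)

end HornVN

end

noncomputable section
namespace HornVN

open Filter Topology

universe u

variable {H : Type u} [NormedAddCommGroup H] [InnerProductSpace ℂ H] [CompleteSpace H]

/-! For distinct `i, j, k` and `x ≤ e i`, put `T j k x = (x ⊔ f k) ⊓ e j`. Since `f k` is disjoint
from `e i` and `e j`, and the traces of `e j` and `f k` sum to 1, this moves `x` into `e j` without
changing its trace (`tr_transfer`). Going around the cycle `e 0 → e 1 → e 2 → e 0` gives a monotone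
trace-preserving map `S` below `e 0`. If `x` had trace 1/6 and `S x = x`, the join of `x` and its
two successive images `y`, `z` would do: each `f k` contains one of the three, and also meets the
join of the other two in trace 1/6, because each of those two lies below the other joined with `f
k`.

An exact fixed point is not needed. Diffuseness gives `x` with `x ⊔ S x` of trace at most `1/6 + ε`
(`exists_almost_invariant`), and adding `w = S x` to the join costs only `ε`.

All trace computations rest on the parallelogram law `tr_sup_add_tr_inf`, which follows from the
equality of the traces of the left and right supports of `(1 - q) p`. Those supports are reached as
limits of `1 - (1 - x*x)^n` and `1 - (1 - xx*)^n`, whose traces agree for each `n`. -/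

/-! ### Supports of contractions and their traces. -/

/-- A lower bound of all powers of a positive contraction `b` is a lower bound of the projection
onto the fixed vectors of `b`. -/
theorem le_of_forall_le_pow {b P y : H →L[ℂ] H} (hb0 : 0 ≤ b) (hb1 : b ≤ 1)
    (hP : IsStarProjection P) (hfix : ∀ h, b h = h ↔ P h = h) (hy : ∀ n, y ≤ b ^ n) : y ≤ P := by
  have hnorm : ‖b‖ ≤ 1 := (CStarAlgebra.norm_le_one_iff_of_nonneg b hb0).2 hb1
  have hysa : IsSelfAdjoint y := by
    have h0 := hy 0
    rw [pow_zero, ContinuousLinearMap.le_def] at h0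
    simpa using (IsSelfAdjoint.one (H →L[ℂ] H)).sub h0.isSelfAdjoint
  rw [ContinuousLinearMap.le_def, ContinuousLinearMap.isPositive_def']
  refine ⟨hP.isSelfAdjoint.sub hysa, fun x => ?_⟩
  -- Mean ergodic theorem: the Cesàro means of the powers of `b` converge strongly to `P`, and each
  -- mean dominates `y`.
  have hlim := ContinuousLinearMap.tendsto_birkhoffAverage_orthogonalProjection b hnorm x
  have hPx : (((b.eqLocus (1 : H →L[ℂ] H)).orthogonalProjectionOnto x :
      (b.eqLocus (1 : H →L[ℂ] H))) : H) = P x := by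
    obtain ⟨_, hp⟩ := isStarProjection_iff_eq_starProjection_range.1 hP
    have hK : P.range = b.eqLocus (1 : H →L[ℂ] H) := by
      ext h
      rw [LinearMap.IsIdempotentElem.mem_range_iff
        (ContinuousLinearMap.isIdempotentElem_toLinearMap_iff.2 hP.isIdempotentElem)]
      exact (hfix h).symm
    conv_rhs => rw [hp]
    simp only [hK]
    rfl
  rw [hPx] at hlim
  have hlim2 : Tendsto (fun n => RCLike.re (inner ℂ (birkhoffAverage ℂ b _root_.id n x) x)) atTop
      (𝓝 (RCLike.re (inner ℂ (P x) x))) :=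
    (RCLike.continuous_re.tendsto _).comp (hlim.inner tendsto_const_nhds)
  have hge : RCLike.re (inner ℂ (y x) x) ≤ RCLike.re (inner ℂ (P x) x) := by
    refine ge_of_tendsto hlim2 ?_
    filter_upwards [eventually_gt_atTop 0] with n hn
    have hterm : ∀ k : ℕ, RCLike.re (inner ℂ (y x) x) ≤ RCLike.re (inner ℂ (b^[k] x) x) := by
      intro k
      have h1 := hy k
      rw [ContinuousLinearMap.le_def, ContinuousLinearMap.isPositive_def'] at h1
      have h2 := h1.2 x
      rw [ContinuousLinearMap.reApplyInnerSelf_apply, _root_.sub_apply,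
        inner_sub_left, map_sub] at h2
      rw [← FunLike.coe_pow_eq_iterate]
      linarith
    have hn' : (0 : ℝ) < n := by exact_mod_cast hn
    have hinv : ((n : ℂ)⁻¹) = (((n : ℝ)⁻¹ : ℝ) : ℂ) := by push_cast; rfl
    rw [birkhoffAverage, birkhoffSum, hinv, inner_smul_left, sum_inner, Complex.conj_ofReal]
    rw [RCLike.re_eq_complex_re, Complex.re_ofReal_mul, Complex.re_sum, inv_mul_eq_div, le_div_iff₀ hn']
    calc _ = ∑ k ∈ Finset.range n, RCLike.re (inner ℂ (y x) x) := by simp [mul_comm]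
      _ ≤ _ := Finset.sum_le_sum fun k _ => hterm k
  rw [ContinuousLinearMap.reApplyInnerSelf_apply, _root_.sub_apply,
    inner_sub_left, map_sub]
  linarith

/-- Since `b P = P = P b`, the difference `b ^ n - P` is the compression of `b ^ n ≥ 0` by `1 - P`.
-/
theorem le_pow_of_fixed {b P : H →L[ℂ] H} (hb0 : 0 ≤ b)
    (hP : IsStarProjection P) (hfix : ∀ h, P h = h → b h = h) (n : ℕ) : P ≤ b ^ n := by
  have hbP : b * P = P := by
    ext h
    refine hfix (P h) ?_
    rw [← mul_apply_eq_comp, hP.isIdempotentElem.eq]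
  have h1 : b ^ n * P = P := by
    induction n with
    | zero => simp
    | succ k ih => rw [pow_succ, mul_assoc, hbP, ih]
  have h2 : P * b ^ n = P := by
    have := congrArg star h1
    rwa [star_mul, hP.isSelfAdjoint.star_eq, ((IsSelfAdjoint.of_nonneg hb0).pow n).star_eq] at this
  have h3 : b ^ n - P = star (1 - P) * b ^ n * (1 - P) := by
    rw [star_sub, star_one, hP.isSelfAdjoint.star_eq, sub_mul, one_mul, h2, mul_sub, mul_one,
      sub_mul, h1, hP.isIdempotentElem.eq, sub_self, sub_zero]
  rw [← sub_nonneg, h3]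
  exact star_left_conjugate_nonneg (CStarAlgebra.pow_nonneg hb0 n) _

variable {M : VonNeumannAlgebra H} {τ : Elt M →ₗ[ℂ] ℂ}

/-- The trace of the support projection of a contraction, as a supremum. -/
theorem isLUB_one_sub_pow (hτ : IsNormalFaithfulTracialState τ) (b : Elt M)
    (hb0 : (0 : H →L[ℂ] H) ≤ b) (hb1 : (b : H →L[ℂ] H) ≤ 1) (c : Proj M)
    (hc : ∀ h, b.1 h = h ↔ c.1 h = 0) :
    IsLUB (Set.range fun n : ℕ => (τ (1 - b ^ n)).re) (tr τ c) := by
  have hP : IsStarProjection (1 - c.1) := c.2.2.one_sub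
  have hfix : ∀ h, b.1 h = h ↔ (1 - c.1) h = h := fun h => by
    rw [hc, _root_.sub_apply, one_apply_eq_self, sub_eq_self]
  have key := hτ.normal (Set.range fun n : ℕ => 1 - b ^ n) c.toElt (Set.range_nonempty _) ?_ ?_ ?_
  · rw [← Set.range_comp] at key
    exact key
  · refine (Monotone.directed_le ?_).directedOn_range
    intro m n hmn
    exact sub_le_sub_left (CStarAlgebra.pow_antitone hb0 hb1 hmn) (1 : H →L[ℂ] H)
  · rintro _ ⟨n, rfl⟩
    change (0 : H →L[ℂ] H) ≤ 1 - b.1 ^ n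
    rw [sub_nonneg]
    simpa using CStarAlgebra.pow_antitone hb0 hb1 (Nat.zero_le n)
  · constructor
    · rintro _ ⟨n, rfl⟩
      change (1 : H →L[ℂ] H) - b.1 ^ n ≤ c.1
      have := le_pow_of_fixed hb0 hP (fun h hh => (hfix h).2 hh) n
      exact sub_le_comm.1 this
    · intro y hy
      change c.1 ≤ y.1
      have : (1 : H →L[ℂ] H) - y.1 ≤ 1 - c.1 := by
        refine le_of_forall_le_pow hb0 hb1 hP hfix fun n => ?_
        have h1 : (1 : H →L[ℂ] H) - b.1 ^ n ≤ y.1 := hy ⟨n, rfl⟩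
        exact sub_le_comm.1 h1
      exact (sub_le_sub_iff_left _).1 this

/-- `x` intertwines `1 - x*x` with `1 - xx*`; moving `x` around the trace then matches the terms
lost from one power to the next. -/
theorem trace_pow_one_sub_star_mul (hτ : IsNormalFaithfulTracialState τ) (x : Elt M) (n : ℕ) :
    τ ((1 - star x * x) ^ n) = τ ((1 - x * star x) ^ n) := by
  have hsemi : SemiconjBy x (1 - star x * x) (1 - x * star x) := by
    simp [SemiconjBy, mul_sub, sub_mul, mul_assoc]
  induction n with
  | zero => simp
  | succ k ih =>
    have h1 := (hsemi.pow_right k).eq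
    have h2 : τ (star x * x * (1 - star x * x) ^ k) = τ (x * star x * (1 - x * star x) ^ k) := by
      rw [mul_assoc, h1, hτ.tracial, hτ.tracial (x * star x), mul_assoc]
    rw [pow_succ', pow_succ', sub_mul, sub_mul, one_mul, one_mul, map_sub, map_sub, ih, h2]

theorem one_sub_star_mul_mem {x : H →L[ℂ] H} (hx : ‖x‖ ≤ 1) :
    0 ≤ 1 - star x * x ∧ 1 - star x * x ≤ 1 := by
  constructor
  · rw [sub_nonneg, ← CStarAlgebra.norm_le_one_iff_of_nonneg _ (star_mul_self_nonneg x),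
      CStarRing.norm_star_mul_self]
    exact mul_le_one₀ hx (norm_nonneg _) hx
  · exact sub_le_self _ (star_mul_self_nonneg x)

theorem one_sub_star_mul_apply_eq_iff (x : H →L[ℂ] H) (h : H) :
    (1 - star x * x) h = h ↔ x h = 0 := by
  rw [_root_.sub_apply, one_apply_eq_self, sub_eq_self]
  constructor
  · intro h0
    have := congrArg (fun v => inner ℂ v h) h0
    simp only [mul_apply_eq_comp, ContinuousLinearMap.star_eq_adjoint,
      ContinuousLinearMap.adjoint_inner_left, inner_zero_left] at this
    exact inner_self_eq_zero.1 this
  · intro h0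
    simp [h0]

/-- The left and right supports of a contraction have the same trace. -/
theorem tr_support_eq (hτ : IsNormalFaithfulTracialState τ) (x : Elt M) (hx : ‖x.1‖ ≤ 1)
    (c d : Proj M) (hc : ∀ h, x.1 h = 0 ↔ c.1 h = 0) (hd : ∀ h, (star x.1) h = 0 ↔ d.1 h = 0) :
    tr τ c = tr τ d := by
  have hb := one_sub_star_mul_mem hx
  have hb' := one_sub_star_mul_mem (x := star x.1) (by rwa [norm_star])
  have h1 := isLUB_one_sub_pow hτ (1 - star x * x) hb.1 hb.2 c
    (fun h => (one_sub_star_mul_apply_eq_iff x.1 h).trans (hc h))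
  have h2 := isLUB_one_sub_pow hτ (1 - star (star x) * star x) hb'.1 hb'.2 d
    (fun h => (one_sub_star_mul_apply_eq_iff (star x.1) h).trans (hd h))
  have heq : (fun n : ℕ => (τ (1 - (1 - star x * x) ^ n)).re) =
      fun n : ℕ => (τ (1 - (1 - star (star x) * star x) ^ n)).re := by
    ext n
    rw [star_star, map_sub, map_sub, trace_pow_one_sub_star_mul hτ]
  rw [heq] at h1
  exact h1.unique h2

/-! ### The projection lattice and the parallelogram law. -/

namespace Proj

theorem mem_range_iff {p : Proj M} {h : H} : h ∈ p.range ↔ p.1 h = h :=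
  LinearMap.IsIdempotentElem.mem_range_iff
    (ContinuousLinearMap.isIdempotentElem_toLinearMap_iff.2 p.2.2.isIdempotentElem)

theorem apply_mem_range (p : Proj M) (h : H) : p.1 h ∈ p.range := ⟨h, rfl⟩

theorem mem_range_inf {p q : Proj M} {h : H} : h ∈ (p ⊓ q).range ↔ h ∈ p.range ∧ h ∈ q.range := by
  change h ∈ (ofSubspace _ _ _ : Proj M).range ↔ _
  rw [range_ofSubspace, Submodule.mem_inf]

theorem range_sup (p q : Proj M) : (p ⊔ q).range = (p.range ⊔ q.range).topologicalClosure :=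
  range_ofSubspace _ _ _

theorem mul_eq_left {p q : Proj M} (h : p ≤ q) : p.1 * q.1 = p.1 :=
  (p.2.2.le_iff_mul_eq_left q.2.2).1 h

theorem mul_eq_right {p q : Proj M} (h : p ≤ q) : q.1 * p.1 = p.1 :=
  (p.2.2.le_iff_mul_eq_right q.2.2).1 h

theorem apply_eq_zero_of_sup {p q : Proj M} {h : H} (hp : p.1 h = 0) (hq : q.1 h = 0) :
    (p ⊔ q).1 h = 0 := by
  have hker : ∀ (r : Proj M) (v : H), r.1 v = 0 ↔ v ∈ r.rangeᗮ := by
    intro r v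
    have : CompleteSpace r.range := r.isClosed_range.completeSpace_coe
    obtain ⟨_, hr⟩ := isStarProjection_iff_eq_starProjection_range.1 r.2.2
    conv_lhs => rw [hr]
    exact Submodule.starProjection_apply_eq_zero_iff (K := r.range)
  rw [hker] at hp hq ⊢
  rw [range_sup, Submodule.orthogonal_closure, ← Submodule.inf_orthogonal]
  exact ⟨hp, hq⟩

/-- The difference of two projections `p ≤ q`. -/
def diff {p q : Proj M} (h : p ≤ q) : Proj M :=
  ⟨q.1 - p.1, sub_mem q.2.1 p.2.1, (p.2.2.le_iff_sub q.2.2).1 h⟩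

theorem zero_le (p : Proj M) : 0 ≤ p := p.2.2.nonneg

end Proj

theorem tr_diff {p q : Proj M} (h : p ≤ q) : tr τ (Proj.diff h) = tr τ q - tr τ p := by
  have : (Proj.diff h).toElt = q.toElt - p.toElt := rfl
  rw [tr, this, map_sub, Complex.sub_re, tr, tr]

theorem tr_zero : tr τ (0 : Proj M) = 0 := by
  have : (0 : Proj M).toElt = 0 := rfl
  rw [tr, this, map_zero, Complex.zero_re]

theorem tr_nonneg (hτ : IsNormalFaithfulTracialState τ) (p : Proj M) : 0 ≤ tr τ p := by
  have h := hτ.nonneg p.toElt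
  have h2 : star p.toElt * p.toElt = p.toElt :=
    Subtype.ext (by
      change star p.1 * p.1 = p.1
      rw [p.2.2.isSelfAdjoint.star_eq, p.2.2.isIdempotentElem.eq])
  rw [h2] at h
  exact (Complex.le_def.1 h).1

theorem eq_zero_of_tr_le_zero (hτ : IsNormalFaithfulTracialState τ) {p : Proj M} (h0 : tr τ p ≤ 0) : p = 0 := by
  have h := hτ.nonneg p.toElt
  have h2 : star p.toElt * p.toElt = p.toElt :=
    Subtype.ext (by
      change star p.1 * p.1 = p.1
      rw [p.2.2.isSelfAdjoint.star_eq, p.2.2.isIdempotentElem.eq])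
  have h3 := hτ.faithful p.toElt (by
    rw [h2] at h ⊢
    obtain ⟨hre, him⟩ := Complex.le_def.1 h
    exact Complex.ext (le_antisymm h0 hre) him.symm)
  exact Subtype.ext (congrArg (fun z : Elt M => z.1) h3)

theorem tr_mono (hτ : IsNormalFaithfulTracialState τ) {p q : Proj M} (h : p ≤ q) : tr τ p ≤ tr τ q := by
  have := tr_nonneg hτ (Proj.diff h)
  rw [tr_diff] at this
  linarith

theorem tr_le_one (hτ : IsNormalFaithfulTracialState τ) (p : Proj M) : tr τ p ≤ 1 := by
  let q : Proj M := ⟨1, one_mem M, IsStarProjection.one _⟩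
  have hq : tr τ q = 1 := by
    have : q.toElt = 1 := rfl
    rw [tr, this, hτ.map_one, Complex.one_re]
  rw [← hq]
  exact tr_mono hτ (show p.1 ≤ 1 from p.2.2.le_one)

/-- The parallelogram law for the trace. -/
theorem tr_sup_add_tr_inf (hτ : IsNormalFaithfulTracialState τ) (p q : Proj M) :
    tr τ (p ⊔ q) + tr τ (p ⊓ q) = tr τ p + tr τ q := by
  -- The right support of `(1 - q) p` is `p - p ⊓ q` and its left support is `p ⊔ q - q`.
  let x : Elt M := (1 - q.toElt) * p.toElt
  have hxval : x.1 = (1 - q.1) * p.1 := rfl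
  have hxs : star x.1 = p.1 * (1 - q.1) := by
    rw [hxval, star_mul, star_sub, star_one, p.2.2.isSelfAdjoint.star_eq,
      q.2.2.isSelfAdjoint.star_eq]
  have hnorm : ‖x.1‖ ≤ 1 := by
    rw [hxval]
    exact (norm_mul_le _ _).trans
      (mul_le_one₀ q.2.2.one_sub.norm_le (norm_nonneg _) p.2.2.norm_le)
  have key := tr_support_eq hτ x hnorm (Proj.diff (inf_le_left : p ⊓ q ≤ p))
    (Proj.diff (le_sup_right : q ≤ p ⊔ q)) ?_ ?_
  · rw [tr_diff, tr_diff] at key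
    linarith
  · intro h
    change p.1 h - q.1 (p.1 h) = 0 ↔ p.1 h - (p ⊓ q).1 h = 0
    have hpq : (p ⊓ q).1 (p.1 h) = (p ⊓ q).1 h := by
      rw [← mul_apply_eq_comp, Proj.mul_eq_left inf_le_left]
    rw [sub_eq_zero, sub_eq_zero, ← hpq, eq_comm, ← Proj.mem_range_iff, eq_comm,
      ← Proj.mem_range_iff, Proj.mem_range_inf]
    exact ⟨fun h1 => ⟨p.apply_mem_range h, h1⟩, fun h1 => h1.2⟩
  · intro h
    rw [hxs]
    change p.1 (h - q.1 h) = 0 ↔ (p ⊔ q).1 h - q.1 h = 0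
    have hq : (p ⊔ q).1 (q.1 h) = q.1 h := by
      rw [← mul_apply_eq_comp, Proj.mul_eq_right le_sup_right]
    have hqq : q.1 (h - q.1 h) = 0 := by
      rw [map_sub, ← mul_apply_eq_comp, q.2.2.isIdempotentElem.eq, sub_self]
    have hs : (p ⊔ q).1 h - q.1 h = (p ⊔ q).1 (h - q.1 h) := by rw [map_sub, hq]
    rw [hs]
    refine ⟨fun h1 => Proj.apply_eq_zero_of_sup h1 hqq, fun h1 => ?_⟩
    rw [← Proj.mul_eq_left (le_sup_left : p ≤ p ⊔ q), mul_apply_eq_comp, h1, map_zero]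

theorem tr_sup_le (hτ : IsNormalFaithfulTracialState τ) (p q : Proj M) : tr τ (p ⊔ q) ≤ tr τ p + tr τ q := by
  have := tr_sup_add_tr_inf hτ p q
  have := tr_nonneg hτ (p ⊓ q)
  linarith

theorem tr_sup_of_inf_eq_zero (hτ : IsNormalFaithfulTracialState τ) {p q : Proj M} (h : p ⊓ q = 0) :
    tr τ (p ⊔ q) = tr τ p + tr τ q := by
  have := tr_sup_add_tr_inf hτ p q
  rw [h, tr_zero] at this
  linarith

/-! ### Suprema of chains and intermediate values of the trace. -/

/-- A nonempty chain of projections has a least upper bound, whose trace is the supremum of the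
traces. -/
theorem exists_isLUB_of_isChain (hτ : IsNormalFaithfulTracialState τ) {c : Set (Proj M)} (hc : IsChain (· ≤ ·) c) (hne : c.Nonempty) :
    ∃ s : Proj M, IsLUB c s ∧ IsLUB (tr τ '' c) (tr τ s) := by
  have : Nonempty c := hne.to_subtype
  let U : c → Submodule ℂ H := fun d => d.1.range
  have hmono : Monotone U := fun a b hab => Proj.le_iff_range_le.1 hab
  let K := (⨆ d, U d).topologicalClosure
  have hinv : ∀ y ∈ M.commutant, K ∈ Module.End.invtSubmodule (y : H →ₗ[ℂ] H) := by
    intro y hy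
    refine Submodule.topologicalClosure_mem_invtSubmodule ?_
    rw [Module.End.mem_invtSubmodule, iSup_le_iff]
    intro d
    exact ((Module.End.mem_invtSubmodule _).1 (d.1.range_invariant hy)).trans
      (Submodule.comap_mono (le_iSup U d))
  let s : Proj M := Proj.ofSubspace K (Submodule.isClosed_topologicalClosure _) hinv
  have hsr : s.range = K := Proj.range_ofSubspace _ _ _
  have hub : ∀ d ∈ c, d ≤ s := fun d hd => by
    rw [Proj.le_iff_range_le, hsr]
    exact (le_iSup U ⟨d, hd⟩).trans (Submodule.le_topologicalClosure _)
  have hdir : IsDirectedOrder c := ⟨fun a b => (hc.total a.2 b.2).elim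
    (fun h => ⟨b, h, le_rfl⟩) (fun h => ⟨a, le_rfl, h⟩)⟩
  -- Normality of `τ` concerns suprema in all of `Elt M`, so `s` must be least among operator
  -- bounds, not only among projections. It is, being the strong limit of the chain.
  have hlub : ∀ y : H →L[ℂ] H, (∀ d ∈ c, d.1 ≤ y) → s.1 ≤ y := by
    intro y hy
    have hysa : IsSelfAdjoint y := by
      obtain ⟨d, hd⟩ := hne
      have h0 := hy d hd
      rw [ContinuousLinearMap.le_def] at h0
      simpa using h0.isSelfAdjoint.add d.2.2.isSelfAdjoint
    rw [ContinuousLinearMap.le_def, ContinuousLinearMap.isPositive_def']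
    refine ⟨hysa.sub s.2.2.isSelfAdjoint, fun x => ?_⟩
    rw [ContinuousLinearMap.reApplyInnerSelf_apply, _root_.sub_apply, inner_sub_left, map_sub,
      sub_nonneg]
    have hop : ∀ d : c, (U d).HasOrthogonalProjection := fun d =>
      ContinuousLinearMap.IsIdempotentElem.hasOrthogonalProjection_range
        d.1.2.2.isIdempotentElem
    have : CompleteSpace K := (Submodule.isClosed_topologicalClosure _).completeSpace_coe
    have hlim := Submodule.starProjection_tendsto_closure_iSup (𝕜 := ℂ) U hmono x
    have hval : ∀ d : c, (U d).starProjection x = d.1.1 x := fun d => by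
      obtain ⟨_, hd⟩ := isStarProjection_iff_eq_starProjection_range.1 d.1.2.2
      conv_rhs => rw [hd]
      rfl
    simp only [hval] at hlim
    have hlim2 : Tendsto (fun d : c => RCLike.re (inner ℂ (d.1.1 x) x)) atTop
        (𝓝 (RCLike.re (inner ℂ (s.1 x) x))) :=
      (RCLike.continuous_re.tendsto _).comp (hlim.inner tendsto_const_nhds)
    refine le_of_tendsto' hlim2 fun d => ?_
    have h1 := hy d.1 d.2
    rw [ContinuousLinearMap.le_def, ContinuousLinearMap.isPositive_def'] at h1
    have h2 := h1.2 x
    rw [ContinuousLinearMap.reApplyInnerSelf_apply, _root_.sub_apply,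
      inner_sub_left, map_sub] at h2
    linarith
  refine ⟨s, ⟨hub, fun y hy => hlub y.1 hy⟩, ?_⟩
  have key := hτ.normal (Proj.toElt '' c) s.toElt (hne.image _) ?_ ?_ ⟨?_, ?_⟩
  · rw [← Set.image_comp] at key
    exact key
  · rintro _ ⟨a, ha, rfl⟩ _ ⟨b, hb, rfl⟩
    rcases hc.total ha hb with h | h
    · exact ⟨_, ⟨b, hb, rfl⟩, h, le_refl b.1⟩
    · exact ⟨_, ⟨a, ha, rfl⟩, le_refl a.1, h⟩
  · rintro _ ⟨a, -, rfl⟩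
    exact a.zero_le
  · rintro _ ⟨a, ha, rfl⟩
    exact hub a ha
  · intro y hy
    exact hlub y.1 fun d hd => hy ⟨d, hd, rfl⟩

/-- A proper nonzero `q ≤ p` and its complement `p - q` share the trace of `p`, so one of them has
at most half. -/
theorem exists_le_tr_le_half (hM : IsDiffuse M) {p : Proj M} (hp : p ≠ 0) :
    ∃ q ≤ p, q ≠ 0 ∧ tr τ q ≤ tr τ p / 2 := by
  obtain ⟨q, hq, hq0, hqp⟩ := hM p hp
  rcases le_total (tr τ q) (tr τ p / 2) with h | h
  · exact ⟨q, hq, hq0, h⟩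
  · refine ⟨Proj.diff hq, ?_, ?_, ?_⟩
    · change p.1 - q.1 ≤ p.1
      exact sub_le_self _ q.2.2.nonneg
    · intro h0
      have h1 : p.1 - q.1 = 0 := congrArg Subtype.val h0
      exact hqp (Subtype.ext (sub_eq_zero.1 h1).symm)
    · rw [tr_diff]
      linarith

theorem exists_le_tr_le (hτ : IsNormalFaithfulTracialState τ) (hM : IsDiffuse M)
    {p : Proj M} (hp : p ≠ 0) {δ : ℝ} (hδ : 0 < δ) :
    ∃ q ≤ p, q ≠ 0 ∧ tr τ q ≤ δ := by
  have h : ∀ n : ℕ, ∃ q ≤ p, q ≠ 0 ∧ tr τ q ≤ (1 / 2) ^ n := by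
    intro n
    induction n with
    | zero => exact ⟨p, le_rfl, hp, by simpa using tr_le_one hτ p⟩
    | succ n ih =>
      obtain ⟨q, hq, hq0, hqt⟩ := ih
      obtain ⟨r, hr, hr0, hrt⟩ := exists_le_tr_le_half (τ := τ) hM hq0
      refine ⟨r, hr.trans hq, hr0, ?_⟩
      rw [pow_succ]
      linarith
  obtain ⟨n, hn⟩ := exists_pow_lt_of_lt_one hδ (by norm_num : (1 / 2 : ℝ) < 1)
  obtain ⟨q, hq, hq0, hqt⟩ := h n
  exact ⟨q, hq, hq0, hqt.trans hn.le⟩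

/-- In a diffuse algebra, the trace takes all intermediate values between two comparable
projections. -/
theorem exists_between_tr_eq (hτ : IsNormalFaithfulTracialState τ) (hM : IsDiffuse M)
    {p q : Proj M} (hpq : p ≤ q) {t : ℝ} (hpt : tr τ p ≤ t)
    (htq : t ≤ tr τ q) : ∃ r, p ≤ r ∧ r ≤ q ∧ tr τ r = t := by
  obtain ⟨m, hpm, hm⟩ := zorn_le_nonempty₀ {r : Proj M | r ≤ q ∧ tr τ r ≤ t} (by
    intro c hcs hc y hy
    obtain ⟨s, hs, hst⟩ := exists_isLUB_of_isChain hτ hc ⟨y, hy⟩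
    refine ⟨s, ⟨hs.2 fun z hz => (hcs hz).1, hst.2 ?_⟩, hs.1⟩
    rintro _ ⟨z, hz, rfl⟩
    exact (hcs hz).2) p ⟨hpq, hpt⟩
  refine ⟨m, hpm, hm.prop.1, le_antisymm hm.prop.2 ?_⟩
  -- If the trace of the maximal `m` fell short of `t`, a nonzero `s ≤ q - m` of trace at most the
  -- gap could be joined to it; maximality gives `s ≤ m`, which with `s ≤ q - m` forces `s = 0`.
  by_contra! hlt
  have hd : Proj.diff hm.prop.1 ≠ 0 := by
    intro h0
    have h1 := tr_diff (τ := τ) hm.prop.1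
    rw [h0, tr_zero] at h1
    linarith
  obtain ⟨s, hs, hs0, hst⟩ := exists_le_tr_le hτ hM hd (sub_pos.2 hlt)
  have hsq : s ≤ q := hs.trans (show q.1 - m.1 ≤ q.1 from sub_le_self _ m.2.2.nonneg)
  have hle : m ⊔ s ≤ m := hm.le_of_ge
    ⟨sup_le hm.prop.1 hsq, by linarith [tr_sup_le hτ m s]⟩ le_sup_left
  have hsm : s ≤ m := le_sup_right.trans hle
  refine hs0 (Subtype.ext ?_)
  have h1 : (q.1 - m.1) * s.1 = s.1 := Proj.mul_eq_right hs
  rw [sub_mul, Proj.mul_eq_right hsq, Proj.mul_eq_right hsm, sub_self] at h1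
  exact h1.symm

theorem Proj.eq_zero_of_le_zero {p : Proj M} (h : p ≤ 0) : p = 0 :=
  le_antisymm h p.zero_le

theorem Proj.inf_eq_zero_of_le {p q p' q' : Proj M} (h : p ⊓ q = 0) (hp : p' ≤ p) (hq : q' ≤ q) :
    p' ⊓ q' = 0 :=
  Proj.eq_zero_of_le_zero ((inf_le_inf hp hq).trans h.le)

/-! ### Transfers and almost invariant projections. -/

/-- Transfer of `x` into `e` along `f` preserves the trace if `f` is a complement of `e` that is
disjoint from `x`. -/
theorem tr_transfer (hτ : IsNormalFaithfulTracialState τ) {x e f : Proj M}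
    (hef : tr τ e + tr τ f = 1) (hxf : x ⊓ f = 0) (hfe : e ⊓ f = 0) :
    tr τ ((x ⊔ f) ⊓ e) = tr τ x := by
  have h1 := tr_sup_add_tr_inf hτ (x ⊔ f) e
  have h2 := tr_sup_of_inf_eq_zero hτ hxf
  have h3 := tr_sup_of_inf_eq_zero hτ hfe
  -- `e ⊔ f` already has trace 1, hence so does `x ⊔ f ⊔ e`.
  have h4 : tr τ (e ⊔ f) ≤ tr τ (x ⊔ f ⊔ e) :=
    tr_mono hτ (sup_le le_sup_right (le_sup_right.trans le_sup_left))
  have h5 := tr_le_one hτ (x ⊔ f ⊔ e)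
  linarith

/-- If `S` is a monotone trace-preserving transformation of the projections below `e`, then there
are projections below `e` of any given trace that are almost invariant under `S`. -/
theorem exists_almost_invariant (hτ : IsNormalFaithfulTracialState τ) (hM : IsDiffuse M)
    {e : Proj M} {S : Proj M → Proj M} (hSe : ∀ x ≤ e, S x ≤ e)
    (hSmono : ∀ x y, x ≤ y → S x ≤ S y) (hStr : ∀ x ≤ e, tr τ (S x) = tr τ x)
    {t : ℝ} (ht0 : 0 ≤ t) (hte : t ≤ tr τ e) {ε : ℝ} (hε : 0 < ε) :
    ∃ q ≤ e, tr τ q = t ∧ tr τ (q ⊔ S q) ≤ t + ε := by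
  obtain ⟨N, hN⟩ := exists_nat_gt (t / ε)
  have hN0 : (0 : ℝ) < N := (div_nonneg ht0 hε.le).trans_lt hN
  have hδ : t / N ≤ ε := by
    rw [div_lt_iff₀ hε] at hN
    rw [div_le_iff₀ hN0]
    linarith
  have hδ0 : 0 ≤ t / N := div_nonneg ht0 hN0.le
  -- Grow `q` in `N` steps of trace `t / N ≤ ε`, keeping `S q` within one step of `q`.
  have key : ∀ k : ℕ, k ≤ N →
      ∃ q ≤ e, tr τ q = k * (t / N) ∧ tr τ (q ⊔ S q) ≤ k * (t / N) + t / N := by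
    intro k
    induction k with
    | zero =>
      intro _
      have hz := hStr 0 e.zero_le
      refine ⟨0, e.zero_le, by simp [tr_zero], ?_⟩
      have := tr_sup_le hτ 0 (S 0)
      rw [hz, tr_zero] at this
      push_cast
      linarith
    | succ k ih =>
      intro hk
      obtain ⟨q, hqe, hqt, hqS⟩ := ih (by omega)
      have hle : ((k + 1 : ℕ) : ℝ) * (t / N) ≤ t := by
        have : ((k + 1 : ℕ) : ℝ) ≤ N := by exact_mod_cast hk
        calc _ ≤ (N : ℝ) * (t / N) := mul_le_mul_of_nonneg_right this hδ0
          _ = t := mul_div_cancel₀ t hN0.ne'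
      -- The next projection `r` absorbs `q ⊔ S q`. Both `r` and `S r` then contain `S q`, so their
      -- meet has trace at least `k * (t / N)` and `r ⊔ S r` exceeds `r` by at most one step.
      obtain ⟨r, hr, hre, hrt⟩ := exists_between_tr_eq hτ hM (sup_le hqe (hSe q hqe))
        (t := ((k + 1 : ℕ) : ℝ) * (t / N)) (by push_cast; linarith) (hle.trans hte)
      refine ⟨r, hre, hrt, ?_⟩
      have h1 := tr_sup_add_tr_inf hτ r (S r)
      have h2 : tr τ (S q) ≤ tr τ (r ⊓ S r) := tr_mono hτ
        (le_inf (le_sup_right.trans hr) (hSmono _ _ (le_sup_left.trans hr)))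
      rw [hStr q hqe] at h2
      rw [hStr r hre] at h1
      push_cast at hrt ⊢
      linarith
  obtain ⟨q, hqe, hqt, hqS⟩ := key N le_rfl
  rw [mul_div_cancel₀ t hN0.ne'] at hqt hqS
  exact ⟨q, hqe, hqt, by linarith⟩

/-- If `y` lies below `x ⊔ f`, then `f` meets `x ⊔ y` in a projection of the trace of `y`;
together with a projection `z ≤ f` disjoint from `x ⊔ y` this gives a lower bound. -/
theorem tr_add_le_tr_inf (hτ : IsNormalFaithfulTracialState τ) {x y z f p : Proj M}
    (hxf : x ⊓ f = 0) (hy : y ≤ x ⊔ f) (hxy : x ⊓ y = 0) (hzf : z ≤ f) (hz : z ⊓ (x ⊔ y) = 0)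
    (hxp : x ≤ p) (hyp : y ≤ p) (hzp : z ≤ p) : tr τ y + tr τ z ≤ tr τ (p ⊓ f) := by
  have h1 := tr_sup_add_tr_inf hτ (x ⊔ y) f
  have h2 := tr_sup_of_inf_eq_zero hτ hxf
  have h3 := tr_sup_of_inf_eq_zero hτ hxy
  -- Joining `y` to `x ⊔ f` adds nothing, so the parallelogram law puts the trace of `y` into `(x ⊔
  -- y) ⊓ f`.
  have h4 : tr τ (x ⊔ y ⊔ f) ≤ tr τ (x ⊔ f) :=
    tr_mono hτ (sup_le (sup_le le_sup_left hy) le_sup_right)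
  have h5 := tr_sup_of_inf_eq_zero hτ (p := z) (q := (x ⊔ y) ⊓ f)
    (Proj.inf_eq_zero_of_le hz le_rfl inf_le_left)
  have h6 : tr τ (z ⊔ (x ⊔ y) ⊓ f) ≤ tr τ (p ⊓ f) := tr_mono hτ
    (sup_le (le_inf hzp hzf) (inf_le_inf_right _ (sup_le hxp hyp)))
  linarith

/-! ### Construction of the projection `p`. -/

/-- The lower bound on the trace of `p` itself serves the top member of the flags in part (b). -/
theorem exists_proj_of_generalPosition (hτ : IsNormalFaithfulTracialState τ) (hM : IsDiffuse M)
    {e f : Fin 3 → Proj M} (hef : ∀ i, e i ≤ f i) (he : ∀ i, tr τ (e i) = 1 / 3)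
    (hf : ∀ i, tr τ (f i) = 2 / 3) (hgp : GeneralPosition e f) {ε : ℝ} (hε : 0 < ε) :
    ∃ p : Proj M, tr τ p ≤ 1 / 2 + ε ∧ 1 / 2 ≤ tr τ p ∧
      (∀ i, 1 / 6 ≤ tr τ (p ⊓ e i)) ∧ (∀ i, 1 / 3 ≤ tr τ (p ⊓ f i)) := by
  obtain ⟨hg1, hg2⟩ := hgp
  have hee : ∀ i j, i ≠ j → e i ⊓ e j = 0 := fun i j hij =>
    Proj.inf_eq_zero_of_le (hg1 i j hij) le_rfl (hef j)
  let T : Fin 3 → Fin 3 → Proj M → Proj M := fun j k x => (x ⊔ f k) ⊓ e j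
  have hTle : ∀ j k x, T j k x ≤ e j := fun j k x => inf_le_right
  have hTle' : ∀ j k x, T j k x ≤ x ⊔ f k := fun j k x => inf_le_left
  have hTmono : ∀ j k x y, x ≤ y → T j k x ≤ T j k y := fun j k x y h =>
    inf_le_inf_right _ (sup_le_sup_right h _)
  have hTtr : ∀ i j k, i ≠ k → j ≠ k → ∀ x ≤ e i, tr τ (T j k x) = tr τ x :=
    fun i j k hik hjk x hx => tr_transfer hτ (by rw [he, hf]; norm_num)
      (Proj.inf_eq_zero_of_le (hg1 i k hik) hx le_rfl) (hg1 j k hjk)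
  let S : Proj M → Proj M := fun x => T 0 1 (T 2 0 (T 1 2 x))
  obtain ⟨x, hxe, hxt, hxS⟩ := exists_almost_invariant hτ hM (e := e 0) (S := S)
    (fun x _ => hTle _ _ _)
    (fun x y h => hTmono _ _ _ _ (hTmono _ _ _ _ (hTmono _ _ _ _ h)))
    (fun x hx => by
      rw [hTtr 2 0 1 (by decide) (by decide) _ (hTle _ _ _),
        hTtr 1 2 0 (by decide) (by decide) _ (hTle _ _ _),
        hTtr 0 1 2 (by decide) (by decide) _ hx])
    (t := 1 / 6) (by norm_num) (by rw [he]; norm_num) hε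
  obtain ⟨y, hy⟩ : ∃ y, y = T 1 2 x := ⟨_, rfl⟩
  obtain ⟨z, hz⟩ : ∃ z, z = T 2 0 y := ⟨_, rfl⟩
  obtain ⟨w, hw⟩ : ∃ w, w = T 0 1 z := ⟨_, rfl⟩
  have hSx : S x = w := by rw [hw, hz, hy]
  rw [hSx] at hxS
  have hye : y ≤ e 1 := hy ▸ hTle _ _ _
  have hze : z ≤ e 2 := hz ▸ hTle _ _ _
  have hwe : w ≤ e 0 := hw ▸ hTle _ _ _
  have hyt : tr τ y = 1 / 6 := by rw [hy, hTtr 0 1 2 (by decide) (by decide) _ hxe, hxt]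
  have hzt : tr τ z = 1 / 6 := by rw [hz, hTtr 1 2 0 (by decide) (by decide) _ hye, hyt]
  have hwt : tr τ w = 1 / 6 := by rw [hw, hTtr 2 0 1 (by decide) (by decide) _ hze, hzt]
  have hdisj : ∀ i j k, i ≠ j → j ≠ k → i ≠ k → ∀ a ≤ e i, ∀ b ≤ e j, ∀ c ≤ e k,
      c ⊓ (a ⊔ b) = 0 := fun i j k hij hjk hik a ha b hb c hc =>
    Proj.inf_eq_zero_of_le (hg2 i j k hij hjk hik) hc (sup_le_sup ha hb)
  have hinf : ∀ i j, i ≠ j → ∀ a ≤ e i, ∀ b ≤ e j, a ⊓ b = 0 := fun i j hij a ha b hb =>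
    Proj.inf_eq_zero_of_le (hee i j hij) ha hb
  have hef0 : ∀ i j, i ≠ j → ∀ a ≤ e i, a ⊓ f j = 0 := fun i j hij a ha =>
    Proj.inf_eq_zero_of_le (hg1 i j hij) ha le_rfl
  -- `w` is needed only for `f 1`: the transfer out of `z` along `f 1` lands on `w`, not on `x`.
  let p := x ⊔ w ⊔ y ⊔ z
  have hxp : x ≤ p := (le_sup_left.trans le_sup_left).trans le_sup_left
  have hwp : w ≤ p := (le_sup_right.trans le_sup_left).trans le_sup_left
  have hyp : y ≤ p := le_sup_right.trans le_sup_left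
  have hzp : z ≤ p := le_sup_right
  refine ⟨p, ?_, ?_, ?_, ?_⟩
  · have h1 := tr_sup_le hτ (x ⊔ w ⊔ y) z
    have h2 := tr_sup_le hτ (x ⊔ w) y
    change tr τ (x ⊔ w ⊔ y ⊔ z) ≤ _
    linarith
  -- By general position `x`, `y`, `z` are independent, so their join has trace exactly 1/2.
  · have h1 := tr_sup_of_inf_eq_zero hτ (hinf 0 1 (by decide) x hxe y hye)
    have h2 := tr_sup_of_inf_eq_zero hτ
      (hdisj 0 1 2 (by decide) (by decide) (by decide) x hxe y hye z hze)
    have h3 : tr τ (z ⊔ (x ⊔ y)) ≤ tr τ p := tr_mono hτ (sup_le hzp (sup_le hxp hyp))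
    linarith
  · intro i
    fin_cases i
    · exact hxt.ge.trans (tr_mono hτ (le_inf hxp hxe))
    · exact hyt.ge.trans (tr_mono hτ (le_inf hyp hye))
    · exact hzt.ge.trans (tr_mono hτ (le_inf hzp hze))
  · intro i
    fin_cases i
    · have := tr_add_le_tr_inf hτ (x := y) (y := z) (z := x) (f := f 0) (p := p)
        (hef0 1 0 (by decide) y hye) (hz ▸ hTle' _ _ _) (hinf 1 2 (by decide) y hye z hze)
        (hxe.trans (hef 0))
        (hdisj 1 2 0 (by decide) (by decide) (by decide) y hye z hze x hxe) hyp hzp hxp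
      change 1 / 3 ≤ tr τ (p ⊓ f 0)
      linarith
    · have := tr_add_le_tr_inf hτ (x := z) (y := w) (z := y) (f := f 1) (p := p)
        (hef0 2 1 (by decide) z hze) (hw ▸ hTle' _ _ _) (hinf 2 0 (by decide) z hze w hwe)
        (hye.trans (hef 1))
        (hdisj 2 0 1 (by decide) (by decide) (by decide) z hze w hwe y hye) hzp hwp hyp
      change 1 / 3 ≤ tr τ (p ⊓ f 1)
      linarith
    · have := tr_add_le_tr_inf hτ (x := x) (y := y) (z := z) (f := f 2) (p := p)
        (hef0 0 2 (by decide) x hxe) (hy ▸ hTle' _ _ _) (hinf 0 1 (by decide) x hxe y hye)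
        (hze.trans (hef 2))
        (hdisj 0 1 2 (by decide) (by decide) (by decide) x hxe y hye z hze) hxp hyp hzp
      change 1 / 3 ≤ tr τ (p ⊓ f 2)
      linarith

/-! ### Flags and part (b). -/

theorem IsFlag.le_of_lt (hτ : IsNormalFaithfulTracialState τ) {F : ℝ → Proj M} (hF : IsFlag τ F)
    {s t : ℝ} (hs : s ∈ Set.Icc (0 : ℝ) 1) (ht : t ∈ Set.Icc (0 : ℝ) 1) (hst : s < t) :
    F s ≤ F t := by
  refine (hF.2 s hs t ht).resolve_right fun h => ?_
  have := tr_mono hτ h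
  rw [hF.1 s hs, hF.1 t ht] at this
  linarith

theorem tr_inf_of_tr_eq_one (hτ : IsNormalFaithfulTracialState τ) {q : Proj M} (hq : tr τ q = 1)
    (p : Proj M) : tr τ (q ⊓ p) = tr τ p := by
  have h1 := tr_sup_add_tr_inf hτ q p
  have h2 := tr_le_one hτ (q ⊔ p)
  have h3 : tr τ q ≤ tr τ (q ⊔ p) := tr_mono hτ le_sup_left
  linarith

end HornVN
end

open HornVN in
theorem mainTheorem10 {H : Type*} [NormedAddCommGroup H] [InnerProductSpace ℂ H] [CompleteSpace H]
    (M : VonNeumannAlgebra H) (hM : IsDiffuse M)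
    (τ : Elt M →ₗ[ℂ] ℂ) (hτ : IsNormalFaithfulTracialState τ) :
    (∀ e f : Fin 3 → Proj M,
      (∀ i, e i ≤ f i) → (∀ i, tr τ (e i) = 1 / 3) → (∀ i, tr τ (f i) = 2 / 3) →
      GeneralPosition e f →
      ∀ ε : ℝ, 0 < ε → ∃ p : Proj M,
        tr τ p ≤ 1 / 2 + ε ∧
        (∀ i, 1 / 6 ≤ tr τ (p ⊓ e i)) ∧
        (∀ i, 1 / 3 ≤ tr τ (p ⊓ f i))) ∧
    (∀ F : Fin 3 → ℝ → Proj M, (∀ m, IsFlag τ (F m)) →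
      GeneralPosition (fun m => F m (2 / 6)) (fun m => F m (4 / 6)) →
      APForFlags τ 6 3 (fun _ => {2, 4, 6}) F) := by
  constructor
  · intro e f hef he hf hgp ε hε
    obtain ⟨p, h1, -, h2, h3⟩ := exists_proj_of_generalPosition hτ hM hef he hf hgp hε
    exact ⟨p, h1, h2, h3⟩
  · intro F hF hgp ε hε
    have hs : (2 / 6 : ℝ) ∈ Set.Icc (0 : ℝ) 1 := by constructor <;> norm_num
    have ht : (4 / 6 : ℝ) ∈ Set.Icc (0 : ℝ) 1 := by constructor <;> norm_num
    obtain ⟨p, h1, h0, h2, h3⟩ := exists_proj_of_generalPosition hτ hM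
      (fun m => (hF m).le_of_lt hτ hs ht (by norm_num))
      (fun m => ((hF m).1 _ hs).trans (by norm_num))
      (fun m => ((hF m).1 _ ht).trans (by norm_num)) hgp hε
    refine ⟨p, by norm_num at h1 ⊢; linarith, fun m i hi => ?_⟩
    -- For the index 6 the flag projection has full trace, so the condition reduces to `1 / 2 ≤ tr τ
    -- p`.
    have h6 : tr τ (F m (6 / 6)) = 1 := by
      rw [(hF m).1 _ (by constructor <;> norm_num)]
      norm_num
    have c2 : (({2, 4, 6} : Finset ℕ).filter (fun i' => i' ≤ 2)).card = 1 := by decide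
    have c4 : (({2, 4, 6} : Finset ℕ).filter (fun i' => i' ≤ 4)).card = 2 := by decide
    have c6 : (({2, 4, 6} : Finset ℕ).filter (fun i' => i' ≤ 6)).card = 3 := by decide
    simp only [Finset.mem_insert, Finset.mem_singleton] at hi
    rcases hi with rfl | rfl | rfl
    · rw [c2]
      refine le_trans (le_of_eq (by norm_num)) ((h2 m).trans (le_of_eq ?_))
      rw [inf_comm]
      rfl
    · rw [c4]
      refine le_trans (le_of_eq (by norm_num)) ((h3 m).trans (le_of_eq ?_))
      rw [inf_comm]
      rfl
    · rw [c6]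
      refine le_trans (le_of_eq (by norm_num)) (h0.trans (le_of_eq ?_))
      exact (tr_inf_of_tr_eq_one hτ h6 p).symm
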